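/- Let $L\ge 0$ be an integer. For an integer $a$ and an integer $k\ge 0$ let $\binom{a}{k}=a(a-1)\cdots(a-k+1)/k!$. For integers $N,M\ge 0$ put $$Z(L;N,M)=\sum\binom{L}{N_r}\prod_{n\ge 1}\binom{P_n'+M_n'}{M_n'}\binom{P_n+M_n}{M_n},\qquad \widetilde Z(L;N,M)=\sum\binom{L}{N_r}\prod_{n\ge 1}\binom{P_n'+M_n'+n}{M_n'}\binom{P_n+M_n}{M_n},$$ where both sums run over all configurations of nonnegative integers $N_r$, $(M_n)_{n\ge1}$, $(M_n')_{n\ge1}$ (with only finitely many $M_n,M'_n$ nonzero) such that $N=N_r+2\sum_{n\ge1} nM_n'$ and $M=\sum_{n\ge1} n(M_n+M_n')$, and where $$P_n'=L-N+2\sum_{m>n}(m-n)M_m',\qquad P_n=N-2M+2\sum_{m>n}(m-n)M_m .$$ Then the following polynomial identities in $u,v$ hold (equivalently, they hold for all elements $u,v$ of every commutative ring): $$\text{(i)}\quad (1+u)^L(1+uv)^L(1-u^2v)(1-v)=\sum_{0\le N\le 2L+2,\ 0\le M\le L+2} Z(L;N,M)\,u^Nv^M,$$ $$\text{(ii)}\quad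 (1+u)^L(1+uv)^L(1-v)=\sum_{0\le N\le 2L,\ 0\le M\le L+1}\widetilde Z(L;N,M)\,u^Nv^M .$$ -/

import Mathlib

/-- A family `(m₁, m₂, …)` of nonnegative integers, almost all zero: `m n` is the number of
strings of length `n` (for `n ≥ 1`). -/
abbrev StringCounts : Type := ℕ+ →₀ ℕ

/-- The total length `∑ₙ n mₙ` of a family of strings. -/
def StringCounts.size (m : StringCounts) : ℕ := m.sum fun n k => (n : ℕ) * k

/-- The integer `2 ∑_{j > n} (j - n) mⱼ`. -/
def StringCounts.excess (m : StringCounts) (n : ℕ+) : ℤ :=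
  2 * m.sum fun j k => if n < j then ((j : ℤ) - (n : ℤ)) * (k : ℤ) else 0

/-- A string configuration: the number `Nr` of real `k`'s, the numbers `Mₙ` of
`Λ`-`n`-strings and the numbers `M'ₙ` of `k`-`Λ`-`2n`-strings. -/
@[ext]
structure StringConfig : Type where
  Nr : ℕ
  lam : StringCounts
  klam : StringCounts

/-- The configurations with `N = Nr + 2 ∑ n M'ₙ` and `M = ∑ n (Mₙ + M'ₙ)`. -/
def StringConfig.admissible (N M : ℕ) : Set StringConfig :=
  {c | c.Nr + 2 * c.klam.size = N ∧ c.lam.size + c.klam.size = M}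

theorem StringCounts.finite_size_le (M : ℕ) : {m : StringCounts | StringCounts.size m ≤ M}.Finite := by
  classical
  refine (Set.finite_Iic
    (Finsupp.indicator (Finset.Icc (1 : ℕ+) M.succPNat) fun _ _ => M : StringCounts)).subset ?_
  intro m hm n
  have hm' : StringCounts.size m ≤ M := hm
  by_cases hn : m n = 0
  · simp [hn]
  have h1 : (n : ℕ) * m n ≤ StringCounts.size m :=
    Finset.single_le_sum (f := fun i : ℕ+ => (i : ℕ) * m i) (fun _ _ => Nat.zero_le _)
      (Finsupp.mem_support_iff.2 hn)
  have h2 : 1 ≤ m n := Nat.one_le_iff_ne_zero.2 hn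
  have h3 : 1 ≤ (n : ℕ) := n.pos
  have h4 : (n : ℕ) ≤ M := by nlinarith
  have h5 : m n ≤ M := by nlinarith
  have h6 : n ∈ Finset.Icc (1 : ℕ+) M.succPNat := by
    refine Finset.mem_Icc.2 ⟨one_le, ?_⟩
    rw [← PNat.coe_le_coe, Nat.succPNat_coe]
    omega
  rw [Finsupp.indicator_of_mem h6]
  exact h5

theorem StringConfig.finite_admissible (N M : ℕ) : (StringConfig.admissible N M).Finite := by
  have hfin := (Set.finite_Iic N).prod
    ((StringCounts.finite_size_le M).prod (StringCounts.finite_size_le M))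
  refine Set.Finite.of_injOn (f := fun c : StringConfig => (c.Nr, c.lam, c.klam)) ?_ ?_ hfin
  · rintro c ⟨h1, h2⟩
    refine ⟨?_, ?_, ?_⟩
    · change c.Nr ≤ N
      omega
    · change c.lam.size ≤ M
      omega
    · change c.klam.size ≤ M
      omega
  · intro c _ d _ h
    simp only [Prod.mk.injEq] at h
    exact StringConfig.ext h.1 h.2.1 h.2.2

/-- `P'ₙ = L - N + 2 ∑_{m > n} (m - n) M'ₘ`. -/
def StringConfig.Pk (c : StringConfig) (L N : ℕ) (n : ℕ+) : ℤ :=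
  (L : ℤ) - (N : ℤ) + c.klam.excess n

/-- `Pₙ = N - 2M + 2 ∑_{m > n} (m - n) Mₘ`. -/
def StringConfig.P (c : StringConfig) (N M : ℕ) (n : ℕ+) : ℤ :=
  (N : ℤ) - 2 * (M : ℤ) + c.lam.excess n

/- `Ring.choose a k` for an integer `a` is the generalized binomial coefficient
`a (a - 1) ⋯ (a - k + 1) / k!`.  Since it is `1` for `k = 0`, the products over all `n ≥ 1`
below are products over the supports of the two families. -/

/-- The number `Z(L; N, M)` of string configurations. -/
noncomputable def stringZ (L N M : ℕ) : ℤ :=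
  ∑ c ∈ (StringConfig.finite_admissible N M).toFinset,
    (L.choose c.Nr : ℤ)
      * (c.klam.prod fun n k => Ring.choose (c.Pk L N n + (k : ℤ)) k)
      * (c.lam.prod fun n k => Ring.choose (c.P N M n + (k : ℤ)) k)

/-- The number `Z̃(L; N, M)` of string configurations. -/
noncomputable def stringZtilde (L N M : ℕ) : ℤ :=
  ∑ c ∈ (StringConfig.finite_admissible N M).toFinset,
    (L.choose c.Nr : ℤ)
      * (c.klam.prod fun n k => Ring.choose (c.Pk L N n + (k : ℤ) + ((n : ℕ) : ℤ)) k)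
      * (c.lam.prod fun n k => Ring.choose (c.P N M n + (k : ℤ)) k)

/-! For fixed $s=\sum nM'_n$ the families $M'$ and $M$ decouple: $N_r=N-2s$, and the two products
may be summed independently over families of total length $s$ and $M-s$. Each sum is a `weight` sum
with offset $a$, and it depends only on $a$ and the length $s$: it is $\binom{a+2s}{s}$ with the
extra $n$ (`sum_weight_one`) and $\binom{a+2s}{s}-\binom{a+2s}{s-1}$ without it. For $a=L-N$ and
$a=N-2M$ the upper entries become $L-N_r$ and $N_r$. Binomial generating functions and
$u(1+v)+(1+u^2v)=(1+u)(1+uv)$ then finish the proof.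

The weight sums are refined by the number of strings. Shortening every string by $1$ gives a
recursion in the total length; Pfaff–Saalschütz shows that explicit products of binomials solve it
(`weightSum_one`, `weightSum_zero`), and Vandermonde sums these over the number of strings. -/

open Finset in
theorem Ring.choose_mul_choose_eq_nat (X : ℤ) (i c : ℕ) :
    Ring.choose X i * Ring.choose (X - i) c = ((i + c).choose c : ℤ) * Ring.choose X (i + c) := by
  have h := Ring.choose_smul_choose X (Nat.le_add_right i c)
  rw [Nat.add_sub_cancel_left] at h
  rw [← h, nsmul_eq_mul, Nat.choose_symm_add]

open Finset in
/-- A form of the Pfaff–Saalschütz identity for generalized binomial coefficients. -/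
theorem Ring.sum_choose_mul_choose_mul_choose (X Y : ℤ) (p : ℕ) :
    ∑ x ∈ HasAntidiagonal.antidiagonal p, Ring.choose (X + Y + x.2) x.2
        * (Ring.choose X (x.1 + 1) * Ring.choose Y x.1)
      = Ring.choose (X + p) (p + 1) * Ring.choose (Y + p + 1) p := by
  have h1 : ∀ x ∈ HasAntidiagonal.antidiagonal p, Ring.choose (X + Y + x.2) x.2
        * (Ring.choose X (x.1 + 1) * Ring.choose Y x.1)
      = ∑ y ∈ HasAntidiagonal.antidiagonal x.2, Ring.choose X (x.1 + y.1 + 1) * ((x.1 + y.1 + 1).choose y.1 : ℤ)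
          * Ring.choose Y x.1 * Ring.choose (Y + p + 1) y.2 := by
    intro x hx
    -- This split lets Vandermonde produce a factor that merges with `Ring.choose X (x.1 + 1)`;
    -- after regrouping, the sum over `x.1` is again a Vandermonde sum.
    have hp : ((x.1 : ℤ) + x.2) = p := by exact_mod_cast HasAntidiagonal.mem_antidiagonal.1 hx
    have e : X + Y + x.2 = (X - ((x.1 + 1 : ℕ) : ℤ)) + (Y + p + 1) := by
      push_cast; rw [← hp]; ring
    rw [e, Ring.add_choose_eq _ (Commute.all _ _), sum_mul]
    refine sum_congr rfl fun y _ => ?_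
    have h := Ring.choose_mul_choose_eq_nat X (x.1 + 1) y.1
    rw [show x.1 + 1 + y.1 = x.1 + y.1 + 1 by ring] at h
    linear_combination Ring.choose (Y + p + 1) y.2 * Ring.choose Y x.1 * h
  have h2 : ∀ y ∈ HasAntidiagonal.antidiagonal p, ∑ x ∈ HasAntidiagonal.antidiagonal y.1,
        Ring.choose X (x.1 + x.2 + 1) * ((x.1 + x.2 + 1).choose x.2 : ℤ)
          * Ring.choose Y x.1 * Ring.choose (Y + p + 1) y.2
      = Ring.choose X (y.1 + 1) * (p.choose y.2 : ℤ) * Ring.choose (Y + p + 1) p := by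
    intro y hy
    have hp := HasAntidiagonal.mem_antidiagonal.1 hy
    have hp' : ((y.1 : ℤ) + y.2) = p := by exact_mod_cast hp
    have h3 : Ring.choose (Y + y.1 + 1) y.1
        = ∑ x ∈ HasAntidiagonal.antidiagonal y.1, Ring.choose Y x.1 * ((y.1 + 1).choose x.2 : ℤ) := by
      rw [add_assoc, Ring.add_choose_eq _ (Commute.all _ _)]
      refine sum_congr rfl fun x _ => ?_
      rw [← Ring.choose_natCast]
      push_cast
      rfl
    have h4 := Ring.choose_mul_choose_eq_nat (Y + p + 1) y.2 y.1
    rw [show Y + p + 1 - y.2 = Y + y.1 + 1 by rw [← hp']; ring, add_comm y.2 y.1, hp,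
      Nat.choose_symm_of_eq_add hp.symm, h3] at h4
    rw [mul_assoc, ← h4, mul_sum, mul_sum]
    refine sum_congr rfl fun x hx => ?_
    rw [HasAntidiagonal.mem_antidiagonal.1 hx]
    ring
  have h5 : ∑ y ∈ HasAntidiagonal.antidiagonal p, Ring.choose X (y.1 + 1) * (p.choose y.2 : ℤ)
      = Ring.choose (X + p) (p + 1) := by
    rw [Ring.add_choose_eq _ (Commute.all _ _), Nat.sum_antidiagonal_succ]
    simp [Ring.choose_natCast]
  rw [sum_congr rfl h1, ← h5, sum_mul, ← sum_congr rfl h2, sum_sigma', sum_sigma']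
  refine sum_nbij' (fun z => ⟨(z.1.1 + z.2.1, z.2.2), (z.1.1, z.2.1)⟩)
    (fun z => ⟨(z.2.1, z.2.2 + z.1.2), (z.2.2, z.1.2)⟩) ?_ ?_ ?_ ?_ ?_
  · rintro ⟨⟨a, b⟩, c, d⟩ h
    simp only [mem_sigma, HasAntidiagonal.mem_antidiagonal, and_true] at h ⊢
    omega
  · rintro ⟨⟨a, b⟩, c, d⟩ h
    simp only [mem_sigma, HasAntidiagonal.mem_antidiagonal, and_true] at h ⊢
    omega
  · rintro ⟨⟨a, b⟩, c, d⟩ h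
    simp only [mem_sigma, HasAntidiagonal.mem_antidiagonal] at h ⊢
    obtain ⟨h, rfl⟩ := h
    rfl
  · rintro ⟨⟨a, b⟩, c, d⟩ h
    simp only [mem_sigma, HasAntidiagonal.mem_antidiagonal] at h ⊢
    obtain ⟨h, rfl⟩ := h
    rfl
  · rintro ⟨⟨a, b⟩, c, d⟩ h
    rfl

/-! ### Families of strings and the removal of one unit from every string -/

namespace StringCounts

/-- The number of strings. -/
def count (m : StringCounts) : ℕ := m.sum fun _ k => k

theorem size_zero : (0 : StringCounts).size = 0 := Finsupp.sum_zero_index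

theorem count_zero : (0 : StringCounts).count = 0 := Finsupp.sum_zero_index

/-- The family with `k` strings of length `1` in which every string of `m` is lengthened by `1`. -/
noncomputable def cons (k : ℕ) (m : StringCounts) : StringCounts :=
  Finsupp.single 1 k + m.embDomain (addRightEmbedding 1)

/-- The family in which the strings of length `1` are removed and the others are shortened
by `1`. -/
noncomputable def tail (m : StringCounts) : StringCounts :=
  m.comapDomain (addRightEmbedding 1) (addRightEmbedding (1 : ℕ+)).injective.injOn

theorem addRightEmbedding_one_ne_one (n : ℕ+) : addRightEmbedding (1 : ℕ+) n ≠ 1 := by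
  intro h
  have := congrArg PNat.val h
  simp at this

theorem embDomain_apply_one (m : StringCounts) : m.embDomain (addRightEmbedding 1) 1 = 0 := by
  refine Finsupp.embDomain_of_notMem_range _ _ _ ?_
  rintro ⟨n, hn⟩
  exact addRightEmbedding_one_ne_one n hn

theorem disjoint_support (k : ℕ) (m : StringCounts) :
    Disjoint (Finsupp.single (1 : ℕ+) k).support (m.embDomain (addRightEmbedding 1)).support := by
  refine Finset.disjoint_of_subset_left Finsupp.support_single_subset ?_
  simpa using fun n _ => addRightEmbedding_one_ne_one n

theorem cons_apply_one (k : ℕ) (m : StringCounts) : cons k m 1 = k := by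
  simp [cons, embDomain_apply_one]

theorem cons_apply_succ (k : ℕ) (m : StringCounts) (n : ℕ+) : cons k m (n + 1) = m n := by
  have h := Finsupp.embDomain_apply_self (addRightEmbedding (1 : ℕ+)) m n
  have h1 := addRightEmbedding_one_ne_one n
  simp only [addRightEmbedding_apply] at h h1
  simp [cons, h, h1.symm]

theorem tail_apply (m : StringCounts) (n : ℕ+) : m.tail n = m (n + 1) := rfl

theorem tail_cons (k : ℕ) (m : StringCounts) : (cons k m).tail = m := by
  ext n
  rw [tail_apply, cons_apply_succ]

theorem cons_tail (m : StringCounts) : cons (m 1) m.tail = m := by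
  ext n
  induction n using PNat.recOn with
  | one => rw [cons_apply_one]
  | succ n _ => rw [cons_apply_succ, tail_apply]

theorem sum_cons {A : Type*} [AddCommMonoid A] (k : ℕ) (m : StringCounts) (f : ℕ+ → ℕ → A)
    (hf : f 1 0 = 0) : (cons k m).sum f = f 1 k + m.sum fun n j => f (n + 1) j := by
  rw [cons, Finsupp.sum_add_index_of_disjoint (disjoint_support k m), Finsupp.sum_single_index hf,
    Finsupp.sum_embDomain]
  rfl

theorem prod_cons {A : Type*} [CommMonoid A] (k : ℕ) (m : StringCounts) (f : ℕ+ → ℕ → A)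
    (hf : f 1 0 = 1) : (cons k m).prod f = f 1 k * m.prod fun n j => f (n + 1) j := by
  rw [cons, Finsupp.prod_add_index_of_disjoint (disjoint_support k m),
    Finsupp.prod_single_index hf, Finsupp.prod_embDomain]
  rfl

theorem count_cons (k : ℕ) (m : StringCounts) : (cons k m).count = k + m.count :=
  sum_cons k m _ rfl

theorem size_cons (k : ℕ) (m : StringCounts) : (cons k m).size = k + (m.size + m.count) := by
  rw [size, sum_cons k m _ (by simp), size, count, ← Finsupp.sum_add]
  simp [add_mul]

theorem excess_cons_one (k : ℕ) (m : StringCounts) : (cons k m).excess 1 = 2 * (m.size : ℤ) := by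
  rw [excess, sum_cons k m _ (by simp), size, Finsupp.sum, Finsupp.sum]
  simp

theorem excess_cons_succ (k : ℕ) (m : StringCounts) (n : ℕ+) :
    (cons k m).excess (n + 1) = m.excess n := by
  rw [excess, sum_cons k m _ (by simp), excess, if_neg (by simp), zero_add]
  simp

theorem count_le_size (m : StringCounts) : m.count ≤ m.size :=
  Finset.sum_le_sum fun n _ => Nat.le_mul_of_pos_left _ n.pos

theorem eq_zero_of_count_eq_zero {m : StringCounts} (h : m.count = 0) : m = 0 := by
  ext n
  by_contra hn
  exact hn ((Finset.sum_eq_zero_iff.1 h) n (Finsupp.mem_support_iff.2 hn))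

/-! ### Weighted sums over families of given length -/

/-- The families of total length `s`. -/
noncomputable def ofSize (s : ℕ) : Finset StringCounts :=
  {m ∈ (finite_size_le s).toFinset | m.size = s}

theorem mem_ofSize {s : ℕ} {m : StringCounts} : m ∈ ofSize s ↔ m.size = s := by
  simp only [ofSize, Finset.mem_filter, Set.Finite.mem_toFinset, Set.mem_ofPred_eq]
  exact ⟨fun h => h.2, fun h => ⟨h.le, h⟩⟩

/-- The product `∏ₙ (a + ε n + 2 ∑_{j > n} (j - n) mⱼ + mₙ choose mₙ)`. -/
noncomputable def weight (a ε : ℤ) (m : StringCounts) : ℤ :=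
  m.prod fun n k => Ring.choose (a + ε * n + m.excess n + k) k

theorem weight_zero (a ε : ℤ) : weight a ε 0 = 1 := Finsupp.prod_zero_index

/-- The excess at $1$ sees the longer strings only through their shortened total length, and the
shift $n\mapsto n+1$ is absorbed by $a\mapsto a+\varepsilon$. -/
theorem weight_cons (a ε : ℤ) (k : ℕ) (m : StringCounts) :
    weight a ε (cons k m) = Ring.choose (a + ε + 2 * m.size + k) k * weight (a + ε) ε m := by
  rw [weight, prod_cons k m _ (by simp), excess_cons_one, weight]
  congr 1
  · simp
  · refine Finsupp.prod_congr fun n _ => ?_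
    rw [excess_cons_succ]
    congr 1
    push_cast
    ring

/-- The sum of the weights of the families of `q` strings of total length `s`. -/
noncomputable def weightSum (a ε : ℤ) (s q : ℕ) : ℤ :=
  ∑ m ∈ ofSize s with m.count = q, weight a ε m

/-- Shortening $q$ strings by $1$ leaves length $t$; the $k$ strings of length $1$ disappear and
$i=q-k$ survive. -/
theorem weightSum_add_self (a ε : ℤ) (t q : ℕ) :
    weightSum a ε (t + q) q = ∑ x ∈ Finset.HasAntidiagonal.antidiagonal q,
      Ring.choose (a + ε + 2 * t + x.2) x.2 * weightSum (a + ε) ε t x.1 := by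
  simp only [weightSum, Finset.mul_sum]
  rw [Finset.sum_sigma']
  refine Finset.sum_nbij' (fun m => ⟨(m.tail.count, m 1), m.tail⟩) (fun z => cons z.1.2 z.2)
    ?_ ?_ ?_ ?_ ?_
  · intro m hm
    rw [← cons_tail m] at hm
    simp only [Finset.mem_filter, mem_ofSize, size_cons, count_cons, Finset.mem_sigma,
      Finset.HasAntidiagonal.mem_antidiagonal, and_true] at hm ⊢
    omega
  · rintro ⟨⟨i, k⟩, m⟩ hm
    simp only [Finset.mem_filter, mem_ofSize, size_cons, count_cons, Finset.mem_sigma,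
      Finset.HasAntidiagonal.mem_antidiagonal] at hm ⊢
    omega
  · intro m _
    exact cons_tail m
  · rintro ⟨⟨i, k⟩, m⟩ hm
    simp only [Finset.mem_filter, Finset.mem_sigma] at hm
    simp [tail_cons, cons_apply_one, hm.2.2]
  · intro m hm
    rw [← cons_tail m] at hm
    simp only [Finset.mem_filter, mem_ofSize, size_cons, count_cons] at hm
    have ht : m.tail.size = t := by omega
    conv_lhs => rw [← cons_tail m]
    rw [weight_cons, ht]

theorem weightSum_succ_zero (a ε : ℤ) (s : ℕ) : weightSum a ε (s + 1) 0 = 0 := by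
  refine Finset.sum_eq_zero fun m hm => ?_
  simp only [Finset.mem_filter, mem_ofSize] at hm
  rw [eq_zero_of_count_eq_zero hm.2, size_zero] at hm
  omega

theorem weightSum_of_lt (a ε : ℤ) {s q : ℕ} (h : s < q) : weightSum a ε s q = 0 := by
  refine Finset.sum_eq_zero fun m hm => ?_
  simp only [Finset.mem_filter, mem_ofSize] at hm
  have := count_le_size m
  omega

theorem weightSum_zero_zero (a ε : ℤ) : weightSum a ε 0 0 = 1 := by
  rw [weightSum, Finset.sum_eq_single 0, weight_zero]
  · intro m hm h0
    simp only [Finset.mem_filter] at hm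
    exact absurd (eq_zero_of_count_eq_zero hm.2) h0
  · intro h
    exact absurd (Finset.mem_filter.2 ⟨mem_ofSize.2 size_zero, count_zero⟩) h

theorem weightSum_self (a ε : ℤ) (p : ℕ) :
    weightSum a ε (p + 1) (p + 1) = Ring.choose (a + ε + (p + 1)) (p + 1) := by
  have h := weightSum_add_self a ε 0 (p + 1)
  rw [zero_add, Finset.Nat.sum_antidiagonal_succ, Finset.sum_eq_zero] at h
  · rw [h]
    simp [weightSum_zero_zero]
  · intro x _
    rw [weightSum_of_lt _ _ (Nat.succ_pos _), mul_zero]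

theorem weightSum_one (s : ℕ) : ∀ (a : ℤ) (p : ℕ),
    weightSum a 1 (s + 1) (p + 1) = Ring.choose (a + s + 2) (p + 1) * (s.choose p : ℤ) := by
  induction s using Nat.strong_induction_on with
  | _ s ih =>
    intro a p
    rcases lt_trichotomy s p with h | rfl | h
    · rw [weightSum_of_lt _ _ (by omega), Nat.choose_eq_zero_of_lt h]
      simp
    · rw [weightSum_self, Nat.choose_self]
      simp only [Nat.cast_one, mul_one]
      congr 1
      ring
    · obtain ⟨t, rfl⟩ := Nat.exists_eq_add_of_lt h
      have hr := weightSum_add_self a 1 (t + 1) (p + 1)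
      rw [Finset.Nat.sum_antidiagonal_succ, weightSum_succ_zero, mul_zero, zero_add] at hr
      rw [show p + t + 1 + 1 = t + 1 + (p + 1) by ring, hr]
      -- Here $s=p+t+1$; `X` and `Y` are the upper entries of the closed form for length $t+1$ at
      -- offset $a+1$.
      have hs := Ring.sum_choose_mul_choose_mul_choose (a + t + 3) t p
      rw [show ((t : ℤ) + p + 1) = ((p + t + 1 : ℕ) : ℤ) by push_cast; ring,
        Ring.choose_natCast] at hs
      rw [show a + ((p + t + 1 : ℕ) : ℤ) + 2 = a + t + 3 + p by push_cast; ring, ← hs]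
      refine Finset.sum_congr rfl fun x _ => ?_
      rw [ih t (by omega), ← Ring.choose_natCast (R := ℤ)]
      congr 2
      · push_cast; ring
      · congr 1; ring

theorem weightSum_zero (s : ℕ) : ∀ (a : ℤ) (p : ℕ),
    weightSum a 0 (s + 1) (p + 1) = Ring.choose (a + s + 2) (p + 1) * (s.choose p : ℤ)
      - Ring.choose (a + s + 1) p * ((s + 1).choose (p + 1) : ℤ) := by
  induction s using Nat.strong_induction_on with
  | _ s ih =>
    intro a p
    rcases lt_trichotomy s p with h | rfl | h
    · rw [weightSum_of_lt _ _ (by omega), Nat.choose_eq_zero_of_lt h,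
        Nat.choose_eq_zero_of_lt (Nat.succ_lt_succ h)]
      simp
    · rw [weightSum_self, Nat.choose_self, Nat.choose_self,
        show a + s + 2 = a + s + 1 + 1 by ring, Ring.choose_succ_succ]
      rw [show a + 0 + ((s : ℤ) + 1) = a + s + 1 by ring]
      simp
    · obtain ⟨t, rfl⟩ := Nat.exists_eq_add_of_lt h
      have hr := weightSum_add_self a 0 (t + 1) (p + 1)
      rw [Finset.Nat.sum_antidiagonal_succ, weightSum_succ_zero, mul_zero, zero_add] at hr
      rw [show p + t + 1 + 1 = t + 1 + (p + 1) by ring, hr]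
      -- One instance for each term of the closed form, both with $X+Y=a+2t+2$. Pascal's rule then
      -- cancels the extra product.
      have hs := Ring.sum_choose_mul_choose_mul_choose (a + t + 2) t p
      have hs' := Ring.sum_choose_mul_choose_mul_choose (t + 1) (a + t + 1) p
      rw [show ((t : ℤ) + p + 1) = ((p + t + 1 : ℕ) : ℤ) by push_cast; ring,
        Ring.choose_natCast] at hs
      rw [show ((t : ℤ) + 1 + p) = ((p + t + 1 : ℕ) : ℤ) by push_cast; ring,
        Ring.choose_natCast] at hs'
      have e1 : a + ((p + t + 1 : ℕ) : ℤ) + 2 = a + t + 2 + p + 1 := by push_cast; ring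
      have e2 : a + ((p + t + 1 : ℕ) : ℤ) + 1 = a + t + 2 + p := by push_cast; ring
      have e3 : a + t + 1 + p + 1 = a + t + 2 + p := by ring
      rw [e3] at hs'
      rw [e1, e2, Ring.choose_succ_succ, show t + 1 + (p + 1) = p + t + 1 + 1 by ring,
        Nat.choose_succ_succ (p + t + 1) p]
      push_cast
      have hsum : ∑ x ∈ Finset.HasAntidiagonal.antidiagonal p,
          Ring.choose (a + 0 + 2 * ((t : ℤ) + 1) + x.2) x.2 * weightSum (a + 0) 0 (t + 1) (x.1 + 1)
          = Ring.choose (a + t + 2 + p) (p + 1) * ((p + t + 1).choose p : ℤ)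
            - ((p + t + 1).choose (p + 1) : ℤ) * Ring.choose (a + t + 2 + p) p := by
        rw [← hs, ← hs', ← Finset.sum_sub_distrib]
        refine Finset.sum_congr rfl fun x _ => ?_
        rw [ih t (by omega), ← Ring.choose_natCast (R := ℤ), ← Ring.choose_natCast (R := ℤ)]
        push_cast
        rw [show a + 0 + 2 * ((t : ℤ) + 1) + x.2 = a + t + 2 + t + x.2 by ring,
          show (t : ℤ) + 1 + (a + t + 1) + x.2 = a + t + 2 + t + x.2 by ring, add_zero]
        ring
      rw [hsum]
      ring

theorem sum_weight_succ (a ε : ℤ) (s : ℕ) :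
    ∑ m ∈ ofSize (s + 1), weight a ε m
      = ∑ x ∈ Finset.HasAntidiagonal.antidiagonal s, weightSum a ε (s + 1) (x.1 + 1) := by
  rw [← Finset.sum_fiberwise_of_maps_to (s := ofSize (s + 1)) (t := Finset.range (s + 2))
    (g := count), Finset.sum_range_succ', Finset.Nat.sum_antidiagonal_eq_sum_range_succ_mk]
  · change _ + weightSum a ε (s + 1) 0 = _
    rw [weightSum_succ_zero, add_zero]
    rfl
  · intro m hm
    have := count_le_size m
    rw [mem_ofSize] at hm
    simp only [Finset.mem_range]
    omega

theorem sum_choose_succ_mul_choose (X : ℤ) (s : ℕ) :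
    ∑ x ∈ Finset.HasAntidiagonal.antidiagonal s, Ring.choose X (x.1 + 1) * (s.choose x.1 : ℤ)
      = Ring.choose (X + s) (s + 1) := by
  rw [Ring.add_choose_eq _ (Commute.all _ _), Finset.Nat.sum_antidiagonal_succ]
  simp only [Ring.choose_natCast, Nat.choose_succ_self, Nat.cast_zero, mul_zero, zero_add]
  refine Finset.sum_congr rfl fun x hx => ?_
  rw [Nat.choose_symm_of_eq_add (Finset.HasAntidiagonal.mem_antidiagonal.1 hx).symm]

theorem sum_choose_mul_choose_succ (X : ℤ) (s : ℕ) :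
    ∑ x ∈ Finset.HasAntidiagonal.antidiagonal s, Ring.choose X x.1 * ((s + 1).choose (x.1 + 1) : ℤ)
      = Ring.choose (X + s + 1) s := by
  rw [add_assoc, Ring.add_choose_eq _ (Commute.all _ _)]
  refine Finset.sum_congr rfl fun x hx => ?_
  have := Finset.HasAntidiagonal.mem_antidiagonal.1 hx
  rw [← Nat.cast_succ, Ring.choose_natCast,
    Nat.choose_symm_of_eq_add (show s + 1 = x.1 + 1 + x.2 by omega)]

theorem ofSize_zero : ofSize 0 = {0} := by
  ext m
  rw [mem_ofSize, Finset.mem_singleton]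
  constructor
  · intro h
    have := count_le_size m
    exact eq_zero_of_count_eq_zero (by omega)
  · rintro rfl
    exact size_zero

theorem sum_weight_one (a : ℤ) (s : ℕ) :
    ∑ m ∈ ofSize s, weight a 1 m = Ring.choose (a + 2 * s) s := by
  cases s with
  | zero => simp [ofSize_zero, weight_zero]
  | succ s =>
    simp only [sum_weight_succ, weightSum_one, sum_choose_succ_mul_choose]
    congr 1
    push_cast
    ring

theorem sum_weight_zero_succ (a : ℤ) (s : ℕ) :
    ∑ m ∈ ofSize (s + 1), weight a 0 m
      = Ring.choose (a + 2 * (s + 1 : ℕ)) (s + 1) - Ring.choose (a + 2 * (s + 1 : ℕ)) s := by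
  simp only [sum_weight_succ, weightSum_zero, Finset.sum_sub_distrib, sum_choose_succ_mul_choose,
    sum_choose_mul_choose_succ]
  congr 2 <;> (push_cast; ring)

theorem sum_weight_zero_zero (a : ℤ) : ∑ m ∈ ofSize 0, weight a 0 m = 1 := by
  simp [ofSize_zero, weight_zero]

end StringCounts

/-! ### Generating functions and assembly -/

/-- The difference `(n choose k) - (n choose (k - 1))`. -/
def chooseDiff (n : ℕ) : ℕ → ℤ
  | 0 => 1
  | k + 1 => (n.choose (k + 1) : ℤ) - n.choose k

theorem chooseDiff_of_lt {n k : ℕ} (h : n + 1 < k) : chooseDiff n k = 0 := by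
  obtain ⟨k, rfl⟩ := Nat.exists_eq_add_of_lt h
  rw [chooseDiff, Nat.choose_eq_zero_of_lt (by omega), Nat.choose_eq_zero_of_lt (by omega)]
  simp

theorem sum_choose_mul_pow {R : Type*} [CommRing R] (n : ℕ) (x : R) :
    ∑ k ∈ Finset.range (n + 1), ((n.choose k : ℤ) : R) * x ^ k = (1 + x) ^ n := by
  rw [add_comm 1 x, add_pow]
  refine Finset.sum_congr rfl fun k _ => ?_
  simp [mul_comm]

theorem sum_chooseDiff_mul_pow {R : Type*} [CommRing R] (n : ℕ) (x : R) :
    ∑ k ∈ Finset.range (n + 2), (chooseDiff n k : R) * x ^ k = (1 + x) ^ n * (1 - x) := by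
  have h : ∑ k ∈ Finset.range (n + 2), ((n.choose k : ℤ) : R) * x ^ k = (1 + x) ^ n := by
    rw [Finset.sum_range_succ, sum_choose_mul_pow, Nat.choose_succ_self]
    simp
  rw [mul_sub, mul_one]
  nth_rw 1 [← h]
  rw [← sum_choose_mul_pow, Finset.sum_range_succ', Finset.sum_range_succ' _ (n + 1)]
  simp only [chooseDiff, Int.cast_sub, sub_mul, Finset.sum_sub_distrib, pow_succ, Finset.sum_mul,
    mul_assoc]
  simp
  ring

theorem StringCounts.sum_weight_zero {a : ℤ} {s n : ℕ} (h : a + 2 * s = n) :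
    ∑ m ∈ ofSize s, weight a 0 m = chooseDiff n s := by
  cases s with
  | zero => exact sum_weight_zero_zero a
  | succ s => rw [sum_weight_zero_succ, h, Ring.choose_natCast, Ring.choose_natCast, chooseDiff]

theorem StringConfig.sum_admissible {A : Type*} [CommSemiring A] (N M : ℕ) (f : ℕ → A)
    (g h : StringCounts → A) :
    ∑ c ∈ (finite_admissible N M).toFinset, f c.Nr * g c.klam * h c.lam
      = ∑ s ∈ Finset.range (M + 1) with 2 * s ≤ N, f (N - 2 * s)
          * (∑ m ∈ StringCounts.ofSize s, g m) * ∑ m ∈ StringCounts.ofSize (M - s), h m := by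
  simp only [Finset.mul_sum, Finset.sum_mul]
  simp only [Finset.sum_sigma']
  refine Finset.sum_nbij' (fun c => ⟨c.klam.size, c.lam, c.klam⟩)
    (fun x => ⟨N - 2 * x.1, x.2.1, x.2.2⟩) ?_ ?_ ?_ ?_ ?_
  · rintro c hc
    obtain ⟨h1, h2⟩ := (Set.Finite.mem_toFinset _).1 hc
    simp only [Finset.mem_sigma, Finset.mem_filter, Finset.mem_range, StringCounts.mem_ofSize,
      and_true]
    omega
  · rintro ⟨s, l, k⟩ hx
    simp only [Finset.mem_sigma, Finset.mem_filter, Finset.mem_range,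
      StringCounts.mem_ofSize] at hx
    refine (Set.Finite.mem_toFinset _).2 ⟨?_, ?_⟩ <;> dsimp only <;> omega
  · rintro c hc
    obtain ⟨h1, h2⟩ := (Set.Finite.mem_toFinset _).1 hc
    refine StringConfig.ext ?_ rfl rfl
    dsimp only
    omega
  · rintro ⟨s, l, k⟩ hx
    simp only [Finset.mem_sigma, Finset.mem_filter, Finset.mem_range,
      StringCounts.mem_ofSize] at hx
    obtain ⟨_, _, rfl⟩ := hx
    rfl
  · rintro c hc
    obtain ⟨h1, h2⟩ := (Set.Finite.mem_toFinset _).1 hc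
    dsimp only
    rw [show N - 2 * c.klam.size = c.Nr by omega]

-- Substitutes $N=r+2s$, $M=s+t$. The bounds on $r,s,t$ force $N\le 2L+2e$ and $M\le L+e+1$, so the
-- rectangle misses no nonzero term.
open Finset in
theorem sum_range_sum_range_sum_filter {R : Type*} [CommRing R] (L e : ℕ) (u v : R)
    (g : ℕ → ℕ → ℕ → ℤ) (hg : ∀ r s t, g r s t ≠ 0 → r ≤ L ∧ s ≤ L - r + e ∧ t ≤ r + 1) :
    ∑ N ∈ range (2 * L + 2 * e + 1), ∑ M ∈ range (L + e + 2),
        ((∑ s ∈ range (M + 1) with 2 * s ≤ N, g (N - 2 * s) s (M - s) : ℤ) : R) * u ^ N * v ^ M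
      = ∑ r ∈ range (L + 1), ∑ s ∈ range (L - r + e + 1), ∑ t ∈ range (r + 2),
          (g r s t : R) * u ^ (r + 2 * s) * v ^ (s + t) := by
  simp only [Int.cast_sum, sum_mul, sum_sigma']
  symm
  refine sum_of_injOn (fun x => ⟨x.1 + 2 * x.2.1, x.2.1 + x.2.2, x.2.1⟩) ?_ ?_ ?_ ?_
  · rintro ⟨r, s, t⟩ _ ⟨r', s', t'⟩ _ h
    simp only [Sigma.mk.injEq, heq_eq_eq] at h
    obtain ⟨h1, h2, rfl⟩ := h
    obtain rfl : r = r' := by omega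
    obtain rfl : t = t' := by omega
    rfl
  · rintro ⟨r, s, t⟩ h
    simp only [coe_sigma, Set.mem_sigma_iff, mem_coe, mem_range, mem_filter] at h ⊢
    omega
  · rintro ⟨N, M, s⟩ h hn
    simp only [mem_sigma, mem_range, mem_filter] at h
    by_cases h0 : g (N - 2 * s) s (M - s) = 0
    · simp [h0]
    · obtain ⟨h1, h2, h3⟩ := hg _ _ _ h0
      refine absurd ⟨⟨N - 2 * s, s, M - s⟩, ?_, ?_⟩ hn
      · simp only [coe_sigma, Set.mem_sigma_iff, mem_coe, mem_range]
        omega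
      · simp only [Sigma.mk.injEq, heq_eq_eq, and_true]
        omega
  · rintro ⟨r, s, t⟩ _
    simp

-- Treats both identities at once: `K n` is the closed form of the $M'$-sum, of degree at most
-- $n+e$, and `c` is the extra factor, $1-u^2v$ for (i) and $1$ for (ii).
open Finset StringCounts in
theorem sum_admissible_weight (L : ℕ) {R : Type*} [CommRing R] (u v : R) (ε : ℤ) (e : ℕ)
    (K : ℕ → ℕ → ℤ) (c : R)
    (hw : ∀ (a : ℤ) (s n : ℕ), a + 2 * s = n → ∑ m ∈ ofSize s, weight a ε m = K n s)
    (h0 : ∀ n s, n + e < s → K n s = 0)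
    (hK : ∀ n, ∑ s ∈ range (n + e + 1), (K n s : R) * (u ^ 2 * v) ^ s
      = (1 + u ^ 2 * v) ^ n * c) :
    ∑ N ∈ range (2 * L + 2 * e + 1), ∑ M ∈ range (L + e + 2),
        ((∑ d ∈ (StringConfig.finite_admissible N M).toFinset, (L.choose d.Nr : ℤ)
          * weight (L - N) ε d.klam * weight (N - 2 * M) 0 d.lam : ℤ) : R) * u ^ N * v ^ M
      = (1 + u) ^ L * (1 + u * v) ^ L * c * (1 - v) := by
  have h1 : ∀ N M : ℕ, ∑ d ∈ (StringConfig.finite_admissible N M).toFinset, (L.choose d.Nr : ℤ)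
        * weight (L - N) ε d.klam * weight (N - 2 * M) 0 d.lam
      = ∑ s ∈ range (M + 1) with 2 * s ≤ N, (L.choose (N - 2 * s) : ℤ)
          * K (L - (N - 2 * s)) s * chooseDiff (N - 2 * s) (M - s) := by
    intro N M
    rw [StringConfig.sum_admissible N M (fun r => (L.choose r : ℤ))]
    refine sum_congr rfl fun s hs => ?_
    simp only [mem_filter, mem_range] at hs
    -- The closed form needs $L-N_r\ge 0$; otherwise $\binom{L}{N_r}$ vanishes.
    rcases lt_or_ge L (N - 2 * s) with h | h
    · simp [Nat.choose_eq_zero_of_lt h]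
    · rw [hw _ _ (L - (N - 2 * s)) (by omega), sum_weight_zero (n := N - 2 * s) (by omega)]
  simp only [h1]
  rw [sum_range_sum_range_sum_filter L e u v
    fun r s t => (L.choose r : ℤ) * K (L - r) s * chooseDiff r t]
  · have h2 : ∀ r ∈ range (L + 1), ∑ s ∈ range (L - r + e + 1), ∑ t ∈ range (r + 2),
          (((L.choose r : ℤ) * K (L - r) s * chooseDiff r t : ℤ) : R) * u ^ (r + 2 * s)
            * v ^ (s + t)
        = (u * (1 + v)) ^ r * (1 + u ^ 2 * v) ^ (L - r) * (L.choose r : R) * (c * (1 - v)) := by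
      intro r _
      have h3 : (u * (1 + v)) ^ r * (1 + u ^ 2 * v) ^ (L - r) * (L.choose r : R) * (c * (1 - v))
          = (L.choose r : R) * u ^ r * (((1 + u ^ 2 * v) ^ (L - r) * c)
            * ((1 + v) ^ r * (1 - v))) := by
        rw [mul_pow]
        ring
      rw [h3, ← hK, ← sum_chooseDiff_mul_pow, sum_mul_sum, mul_sum]
      refine sum_congr rfl fun s _ => ?_
      rw [mul_sum]
      refine sum_congr rfl fun t _ => ?_
      push_cast
      ring
    rw [sum_congr rfl h2, ← sum_mul, ← add_pow, ← mul_pow]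
    ring
  · intro r s t h
    refine ⟨?_, ?_, ?_⟩ <;> by_contra hlt <;> refine h ?_
    · simp [Nat.choose_eq_zero_of_lt (not_le.1 hlt)]
    · simp [h0 _ _ (not_le.1 hlt)]
    · simp [chooseDiff_of_lt (not_le.1 hlt)]

theorem stringZ_eq (L N M : ℕ) :
    stringZ L N M = ∑ d ∈ (StringConfig.finite_admissible N M).toFinset, (L.choose d.Nr : ℤ)
      * StringCounts.weight (L - N) 0 d.klam * StringCounts.weight (N - 2 * M) 0 d.lam := by
  simp [stringZ, StringCounts.weight, StringConfig.Pk, StringConfig.P]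

theorem stringZtilde_eq (L N M : ℕ) :
    stringZtilde L N M = ∑ d ∈ (StringConfig.finite_admissible N M).toFinset, (L.choose d.Nr : ℤ)
      * StringCounts.weight (L - N) 1 d.klam * StringCounts.weight (N - 2 * M) 0 d.lam := by
  have h (d : StringConfig) (n : ℕ+) (k : ℕ) : (L : ℤ) - N + d.klam.excess n + k + (n : ℕ)
      = (L : ℤ) - N + (n : ℕ) + d.klam.excess n + k := by ring
  simp [stringZtilde, StringCounts.weight, StringConfig.Pk, StringConfig.P, h]

theorem proposition3 (L : ℕ) {R : Type*} [CommRing R] (u v : R) :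
    ((1 + u) ^ L * (1 + u * v) ^ L * (1 - u ^ 2 * v) * (1 - v)
        = ∑ N ∈ Finset.range (2 * L + 3), ∑ M ∈ Finset.range (L + 3),
            (stringZ L N M : R) * u ^ N * v ^ M) ∧
    ((1 + u) ^ L * (1 + u * v) ^ L * (1 - v)
        = ∑ N ∈ Finset.range (2 * L + 1), ∑ M ∈ Finset.range (L + 2),
            (stringZtilde L N M : R) * u ^ N * v ^ M) := by
  constructor
  · simp only [stringZ_eq]
    exact (sum_admissible_weight L u v 0 1 chooseDiff _
      (fun _ _ _ h => StringCounts.sum_weight_zero h) (fun _ _ h => chooseDiff_of_lt h)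
      fun n => sum_chooseDiff_mul_pow n _).symm
  · simp only [stringZtilde_eq]
    have h := sum_admissible_weight L u v 1 0 (fun n s => (n.choose s : ℤ)) 1
      (fun a s n h => by rw [StringCounts.sum_weight_one, h, Ring.choose_natCast])
      (fun n s h => by rw [Nat.choose_eq_zero_of_lt (by omega), Nat.cast_zero])
      (fun n => by rw [mul_one]; exact sum_choose_mul_pow n _)
    rw [mul_one] at h
    exact h.symm
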